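/- Let $\mathcal H_A,\mathcal H_B$ be finite-dimensional complex Hilbert spaces and let $\rho^{AB}$ be a state (positive semidefinite operator of unit trace) on $\mathcal H_A\otimes\mathcal H_B$, with reduced states $\rho^A=\mathrm{Tr}_B\,\rho^{AB}$ and $\rho^B=\mathrm{Tr}_A\,\rho^{AB}$. For a state $\rho^X$ of a system $X$ let $S(X)=-\mathrm{Tr}\,\rho^X\log_2\rho^X$ be its von Neumann entropy. Let $I(A:B)=S(A)+S(B)-S(AB)$ and $$J(A|B)=\sup_{\{E_i\}}\Big(S(A)-\sum_i p_i\,S(\rho_i^A)\Big),$$ where $\{E_i\}$ runs over all POVMs on $\mathcal H_B$ with finitely many outcomes, $p_i=\mathrm{Tr}\big((1\otimes E_i)\rho^{AB}\big)$ and $\rho^A_i=\mathrm{Tr}_B\big((1\otimes E_i)\rho^{AB}\big)/p_i$ (terms with $p_i=0$ are omitted). The quantum discord is $D(A|B)=I(A:B)-J(A|B)$. Then: 1. $D(A|B)\le S(B)$. 2. $D(A|B)=S(B)$ if and only if there are finite-dimensional Hilbert spaces $\mathcal H_{A^L},\mathcal H_{A^R}$ and a linear isometry $V:\mathcal H_{A^L}\otimes\mathcal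 H_{A^R}\to\mathcal H_A$ (an identification of $\mathcal H_{A^L}\otimes\mathcal H_{A^R}$ with a subspace of $\mathcal H_A$), a state $\rho^{A^L}$ on $\mathcal H_{A^L}$ and a unit vector $\psi\in\mathcal H_{A^R}\otimes\mathcal H_B$ such that $$\rho^{AB}=(V\otimes 1_B)\,\big(\rho^{A^L}\otimes|\psi\rangle\langle\psi|^{A^RB}\big)\,(V\otimes 1_B)^\dagger .$$ 3. If $\rho^A$ has full rank (that is, if $\mathcal H_A$ is the support of $\rho^A$), then $D(A|B)=S(B)$ if and only if the same holds with $V$ unitary, that is, $\mathcal H_A=\mathcal H_{A^L}\otimes\mathcal H_{A^R}$ with $\rho^{AB}=\rho^{A^L}\otimes|\psi\rangle\langle\psi|^{A^RB}$. -/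

import Mathlib

open scoped Matrix Kronecker ComplexOrder

noncomputable section

namespace QuantumDiscord

/-- A quantum state (density matrix) on the finite-dimensional Hilbert space `ℂ^n`:
a positive semidefinite matrix of unit trace. -/
def IsState {n : Type*} [Fintype n] (ρ : Matrix n n ℂ) : Prop :=
  ρ.PosSemidef ∧ ρ.trace = 1

/-- The partial trace over the second factor, `Tr_B`. -/
def traceB {A B : Type*} [Fintype B] (M : Matrix (A × B) (A × B) ℂ) : Matrix A A ℂ :=
  Matrix.of fun i j => ∑ b, M (i, b) (j, b)

/-- The partial trace over the first factor, `Tr_A`. -/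
def traceA {A B : Type*} [Fintype A] (M : Matrix (A × B) (A × B) ℂ) : Matrix B B ℂ :=
  Matrix.of fun i j => ∑ a, M (a, i) (a, j)

/-- The von Neumann entropy `S(ρ) = -Tr (ρ log₂ ρ)`. The logarithm is taken by the functional
calculus; since `Real.logb 2 0 = 0`, the convention `0 log 0 = 0` is respected. -/
def entropy {n : Type*} [Fintype n] [DecidableEq n] (ρ : Matrix n n ℂ) : ℝ :=
  -(ρ * cfc (Real.logb 2) ρ).trace.re

/-- The mutual information `I(A:B) = S(A) + S(B) - S(AB)`. -/
def mutualInfo {A B : Type*} [Fintype A] [Fintype B] [DecidableEq A] [DecidableEq B]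
    (ρ : Matrix (A × B) (A × B) ℂ) : ℝ :=
  entropy (traceB ρ) + entropy (traceA ρ) - entropy ρ

/-- A positive operator valued measure with outcomes `Fin k`: positive semidefinite operators
that sum to the identity. -/
def IsPOVM {B : Type*} [Fintype B] [DecidableEq B] {k : ℕ} (E : Fin k → Matrix B B ℂ) : Prop :=
  (∀ i, (E i).PosSemidef) ∧ ∑ i, E i = 1

/-- The probability `Tr ((1 ⊗ E) ρ)` of the outcome with effect `E` on `B`. -/
def outcomeProb {A B : Type*} [Fintype A] [Fintype B] [DecidableEq A]
    (ρ : Matrix (A × B) (A × B) ℂ) (E : Matrix B B ℂ) : ℝ :=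
  (((1 : Matrix A A ℂ) ⊗ₖ E) * ρ).trace.re

/-- The (normalized) state of `A` after the outcome with effect `E` on `B`,
`Tr_B ((1 ⊗ E) ρ) / p` with `p` the probability of that outcome. (If `p = 0` this is `0`; such
outcomes have weight `0` wherever this is used.) -/
def postState {A B : Type*} [Fintype A] [Fintype B] [DecidableEq A]
    (ρ : Matrix (A × B) (A × B) ℂ) (E : Matrix B B ℂ) : Matrix A A ℂ :=
  (outcomeProb ρ E)⁻¹ • traceB (((1 : Matrix A A ℂ) ⊗ₖ E) * ρ)

/-- The information `S(A) - ∑ i, p i * S(A|E i)` about `A` gained by the measurement `E` on `B`. -/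
def measuredInfo {A B : Type*} [Fintype A] [Fintype B] [DecidableEq A]
    (ρ : Matrix (A × B) (A × B) ℂ) {k : ℕ} (E : Fin k → Matrix B B ℂ) : ℝ :=
  entropy (traceB ρ) - ∑ i, outcomeProb ρ (E i) * entropy (postState ρ (E i))

/-- The classical correlation `J(A|B)`, optimized over all POVMs on `B` with any finite number of
outcomes. -/
def classicalCorr {A B : Type*} [Fintype A] [Fintype B] [DecidableEq A] [DecidableEq B]
    (ρ : Matrix (A × B) (A × B) ℂ) : ℝ :=
  sSup {x : ℝ | ∃ (k : ℕ) (E : Fin k → Matrix B B ℂ), IsPOVM E ∧ measuredInfo ρ E = x}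

/-- The quantum discord `D(A|B) = I(A:B) - J(A|B)`, where `B` is the measured subsystem. -/
def discord {A B : Type*} [Fintype A] [Fintype B] [DecidableEq A] [DecidableEq B]
    (ρ : Matrix (A × B) (A × B) ℂ) : ℝ :=
  mutualInfo ρ - classicalCorr ρ

/-- The state `σ ⊗ |ψ⟩⟨ψ|` with `σ` on `L` and `ψ` on `R ⊗ B`, regarded as a matrix
on `(L ⊗ R) ⊗ B`. -/
def stateTensorPure {L R B : Type*} (σ : Matrix L L ℂ) (ψ : R × B → ℂ) :
    Matrix ((L × R) × B) ((L × R) × B) ℂ :=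
  (σ ⊗ₖ Matrix.vecMulVec ψ (star ψ)).submatrix (Equiv.prodAssoc L R B) (Equiv.prodAssoc L R B)

/-- `ρ = σ ⊗ |ψ⟩⟨ψ|` for some state `σ` on `L` and some unit vector `ψ` in `R ⊗ B`, when `L ⊗ R`
is mapped into the space of `A` by `V`. -/
def IsStateTensorPure {A B L R : Type*} [Fintype A] [Fintype B] [Fintype L] [Fintype R]
    [DecidableEq B] (ρ : Matrix (A × B) (A × B) ℂ) (V : Matrix A (L × R) ℂ) : Prop :=
  ∃ (σ : Matrix L L ℂ) (ψ : R × B → ℂ), IsState σ ∧ star ψ ⬝ᵥ ψ = 1 ∧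
    ρ = (V ⊗ₖ (1 : Matrix B B ℂ)) * stateTensorPure σ ψ * (V ⊗ₖ (1 : Matrix B B ℂ))ᴴ

end QuantumDiscord

end

namespace QuantumDiscord

open Matrix

/-! Cancelling `S(A) + S(B)`, the bound says `J(A|B) ≥ S(A) - S(AB)`: some measurement leaves
average entropy at most `S(AB)` on A. Write `ρ = M Mᴴ`; the column index C of `M` plays the role of
a purifying system. A rank one effect `|e⟩⟨e|` leaves on A the unnormalised state `X Xᴴ` with `X =
slice M e`, which has the nonzero spectrum of `Xᴴ X` on C. For a rank one POVM these Gram matrices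
sum to `Mᴴ M`, whose entropy is `S(AB)`, so concavity gives the bound (`sum_entropy_postState_le`).

If the discord equals `S(B)`, every rank one POVM is tight. Strict concavity, and the fact that each
unit vector belongs to such a POVM, make every `Xᴴ X` proportional to `Mᴴ M`
(`gram_slice_of_discord_eq`). By polarization (`gram_block_eq`) the marginal on CB of the
purification is then a product, up to transposition. Purifications of a product differ by an
isometry on the purifying system A, and this isometry is `V` (`exists_isStateTensorPure`).

Conversely, measuring B in `σ ⊗ |ψ⟩⟨ψ|` leaves `σ` untouched, so the average entropy is never below
`S(σ) = S(AB)` (`classicalCorr_le_of_isStateTensorPure`). -/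

lemma mul_diagonal_conjTranspose_apply {n m : Type*} [Fintype m] [DecidableEq m]
    (U : Matrix n m ℂ) (d : m → ℝ) (i j : n) :
    (U * (diagonal fun k => (d k : ℂ)) * Uᴴ) i j = ∑ k, U i k * d k * star (U j k) := by
  rw [Matrix.mul_apply]
  simp only [mul_diagonal, conjTranspose_apply]

lemma sum_normSq_row {n m : Type*} [Fintype m] [DecidableEq n]
    {U : Matrix n m ℂ} (hU : U * Uᴴ = 1) (i : n) :
    ∑ k, Complex.normSq (U i k) = 1 := by
  have h := congrFun (congrFun hU i) i
  rw [Matrix.mul_apply, one_apply_eq] at h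
  have h' := congrArg Complex.re h
  simpa [Complex.re_sum, Complex.normSq_apply] using h'

lemma re_mul_diagonal_conjTranspose_apply_self {n m : Type*} [Fintype m] [DecidableEq m]
    (U : Matrix n m ℂ) (d : m → ℝ) (i : n) :
    ((U * (diagonal fun k => (d k : ℂ)) * Uᴴ) i i).re = ∑ k, Complex.normSq (U i k) * d k := by
  rw [mul_diagonal_conjTranspose_apply, Complex.re_sum]
  refine Finset.sum_congr rfl fun k _ => ?_
  rw [mul_right_comm, Complex.star_def, Complex.mul_conj, ← Complex.ofReal_mul, Complex.ofReal_re]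

lemma sum_normSq_col {n m : Type*} [Fintype n] [DecidableEq m]
    {U : Matrix n m ℂ} (hU : Uᴴ * U = 1) (k : m) :
    ∑ i, Complex.normSq (U i k) = 1 := by
  have h := sum_normSq_row (U := Uᴴ) (by simpa using hU) k
  simpa using h

/-! ### Von Neumann entropy: invariance under isometries, strict concavity, additivity. -/

section Entropy

variable {n m : Type*} [Fintype n] [Fintype m] [DecidableEq n] [DecidableEq m]

/-- On two Hermitian matrices at once, the functional calculus is given by one polynomial. -/
lemma exists_polynomial_cfc_eq (f : ℝ → ℝ) {X : Matrix n n ℂ} {Y : Matrix m m ℂ}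
    (hX : X.IsHermitian) (hY : Y.IsHermitian) :
    ∃ q : Polynomial ℝ, cfc f X = Polynomial.aeval X q ∧ cfc f Y = Polynomial.aeval Y q := by
  classical
  have hfin : (spectrum ℝ X ∪ spectrum ℝ Y).Finite :=
    X.finite_real_spectrum.union Y.finite_real_spectrum
  -- Both spectra are finite, so one interpolant on their union serves both matrices.
  let q : Polynomial ℝ := Lagrange.interpolate hfin.toFinset id f
  have hq : ∀ x ∈ spectrum ℝ X ∪ spectrum ℝ Y, f x = q.eval x := by
    intro x hx
    exact (Lagrange.eval_interpolate_at_node f (s := hfin.toFinset) (v := id)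
      Function.injective_id.injOn (hfin.mem_toFinset.2 hx)).symm
  have hX' : IsSelfAdjoint X := hX
  have hY' : IsSelfAdjoint Y := hY
  refine ⟨q, ?_, ?_⟩
  · rw [← cfc_polynomial q X hX']
    exact cfc_congr fun x hx => hq x (Or.inl hx)
  · rw [← cfc_polynomial q Y hY']
    exact cfc_congr fun x hx => hq x (Or.inr hx)

lemma aeval_mul_intertwine (M : Matrix n m ℂ) (N : Matrix m n ℂ) (q : Polynomial ℝ) :
    Polynomial.aeval (M * N) q * M = M * Polynomial.aeval (N * M) q := by
  induction q using Polynomial.induction_on' with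
  | add p q hp hq => simp only [map_add, Matrix.add_mul, Matrix.mul_add, hp, hq]
  | monomial k a =>
    have hk : ∀ k : ℕ, (M * N) ^ k * M = M * (N * M) ^ k := by
      intro k
      induction k with
      | zero => simp
      | succ k ih => rw [pow_succ', Matrix.mul_assoc, ih, pow_succ', Matrix.mul_assoc,
          Matrix.mul_assoc]
    simp only [Polynomial.aeval_monomial, Algebra.algebraMap_eq_smul_one, smul_mul_assoc,
      one_mul, Matrix.smul_mul, Matrix.mul_smul, hk]

/-- Both products have the same nonzero spectrum, and zero eigenvalues do not contribute. Spectra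
are avoided: one polynomial represents the logarithm on both sides, and `q(M Mᴴ) M = M q(Mᴴ M)`
together with cyclicity of the trace does the rest. -/
lemma entropy_mul_conjTranspose_self (M : Matrix n m ℂ) :
    entropy (M * Mᴴ) = entropy (Mᴴ * M) := by
  obtain ⟨q, h1, h2⟩ := exists_polynomial_cfc_eq (Real.logb 2)
    (isHermitian_mul_conjTranspose_self M) (isHermitian_conjTranspose_mul_self M)
  unfold entropy
  rw [h1, h2, Matrix.mul_assoc, Matrix.trace_mul_comm, Matrix.mul_assoc, aeval_mul_intertwine,
    ← Matrix.mul_assoc]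

lemma aeval_diagonal (d : n → ℂ) (q : Polynomial ℝ) :
    Polynomial.aeval (diagonal d) q = diagonal fun i => Polynomial.aeval (d i) q := by
  have h := Polynomial.aeval_algHom_apply (Matrix.diagonalAlgHom ℝ (n := n) (α := ℂ)) d q
  have e : (Matrix.diagonalAlgHom ℝ (n := n) (α := ℂ)) d = diagonal d := rfl
  rw [e] at h
  rw [h]
  change diagonal _ = _
  congr 1
  ext i
  have := Polynomial.aeval_algHom_apply (Pi.evalAlgHom ℝ (fun _ : n => ℂ) i) d q
  exact this.symm

lemma entropy_diagonal (d : n → ℝ) :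
    entropy (diagonal fun i => (d i : ℂ)) = ∑ i, Real.negMulLog (d i) / Real.log 2 := by
  have hH : (diagonal fun i => (d i : ℂ)).IsHermitian := by
    rw [IsHermitian, diagonal_conjTranspose]
    congr 1
    ext i
    simp
  have hs : IsSelfAdjoint (diagonal fun i => (d i : ℂ)) := hH
  let q : Polynomial ℝ := Lagrange.interpolate (Finset.univ.image d) id (Real.logb 2)
  have hq : ∀ i, Real.logb 2 (d i) = q.eval (d i) := fun i =>
    (Lagrange.eval_interpolate_at_node (Real.logb 2) (s := Finset.univ.image d) (v := id)
      Function.injective_id.injOn (by simp)).symm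
  have hcfc : cfc (Real.logb 2) (diagonal fun i => (d i : ℂ)) =
      diagonal fun i => ((Real.logb 2 (d i) : ℝ) : ℂ) := by
    have h1 : cfc (Real.logb 2) (diagonal fun i => (d i : ℂ)) =
        cfc q.eval (diagonal fun i => (d i : ℂ)) := by
      refine cfc_congr fun x hx => ?_
      have hx' : (algebraMap ℝ ℂ x) ∈ spectrum ℂ (diagonal fun i => (d i : ℂ)) :=
        (spectrum.algebraMap_mem_iff ℂ).2 hx
      rw [spectrum_diagonal] at hx'
      obtain ⟨i, hi⟩ := hx'
      have : d i = x := by simpa using hi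
      rw [← this]
      exact hq i
    rw [h1, cfc_polynomial q _ hs, aeval_diagonal]
    congr 1
    ext i
    rw [hq i, ← Polynomial.coe_aeval_eq_eval]
    exact (Polynomial.aeval_algHom_apply (Complex.ofRealAm) (d i) q)
  unfold entropy
  rw [hcfc, diagonal_mul_diagonal, trace_diagonal, Complex.re_sum, ← Finset.sum_neg_distrib]
  refine Finset.sum_congr rfl fun i _ => ?_
  rw [← Complex.ofReal_mul, Complex.ofReal_re, Real.negMulLog, Real.logb]
  ring

/-- With `s = √d`, the matrix is `(V s)(V s)ᴴ`, and swapping the factors cancels `V`. -/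
lemma entropy_isometry_diagonal {V : Matrix n m ℂ} (hV : Vᴴ * V = 1)
    {d : m → ℝ} (hd : ∀ i, 0 ≤ d i) :
    entropy (V * (diagonal fun i => (d i : ℂ)) * Vᴴ) =
      ∑ i, Real.negMulLog (d i) / Real.log 2 := by
  let s : Matrix m m ℂ := diagonal fun i => ((Real.sqrt (d i) : ℝ) : ℂ)
  have hs : sᴴ = s := by
    simp only [s, diagonal_conjTranspose]
    congr 1
    ext i
    simp
  have hss : s * s = diagonal fun i => (d i : ℂ) := by
    simp only [s, diagonal_mul_diagonal, ← Complex.ofReal_mul, Real.mul_self_sqrt (hd _)]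
  have h1 : V * (diagonal fun i => (d i : ℂ)) * Vᴴ = (V * s) * (V * s)ᴴ := by
    rw [conjTranspose_mul, hs, ← hss]
    simp only [Matrix.mul_assoc]
  have h2 : (V * s)ᴴ * (V * s) = diagonal fun i => (d i : ℂ) := by
    rw [conjTranspose_mul, hs, Matrix.mul_assoc, ← Matrix.mul_assoc Vᴴ, hV, Matrix.one_mul, hss]
  rw [h1, entropy_mul_conjTranspose_self, h2, entropy_diagonal]

lemma exists_eq_unitary_diagonal {X : Matrix n n ℂ} (hX : X.PosSemidef) :
    ∃ (U : Matrix n n ℂ) (d : n → ℝ), Uᴴ * U = 1 ∧ U * Uᴴ = 1 ∧ (∀ i, 0 ≤ d i) ∧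
      X = U * (diagonal fun i => (d i : ℂ)) * Uᴴ := by
  refine ⟨hX.1.eigenvectorUnitary, hX.1.eigenvalues, ?_, ?_, hX.eigenvalues_nonneg, ?_⟩
  · exact Unitary.coe_star_mul_self hX.1.eigenvectorUnitary
  · exact Unitary.coe_mul_star_self hX.1.eigenvectorUnitary
  · exact hX.1.spectral_theorem

lemma exists_eq_mul_conjTranspose {X : Matrix n n ℂ} (hX : X.PosSemidef) :
    ∃ T : Matrix n n ℂ, X = T * Tᴴ := by
  obtain ⟨U, d, -, -, hd, rfl⟩ := exists_eq_unitary_diagonal hX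
  let s : Matrix n n ℂ := diagonal fun i => ((Real.sqrt (d i) : ℝ) : ℂ)
  have hs : sᴴ = s := by
    simp only [s, diagonal_conjTranspose]
    congr 1
    ext i
    simp
  have hss : s * s = diagonal fun i => (d i : ℂ) := by
    simp only [s, diagonal_mul_diagonal, ← Complex.ofReal_mul, Real.mul_self_sqrt (hd _)]
  refine ⟨U * s, ?_⟩
  rw [conjTranspose_mul, hs, ← hss]
  simp only [Matrix.mul_assoc]

lemma entropy_isometry_conj {V : Matrix m n ℂ} (hV : Vᴴ * V = 1) {X : Matrix n n ℂ}
    (hX : X.PosSemidef) : entropy (V * X * Vᴴ) = entropy X := by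
  obtain ⟨T, rfl⟩ := exists_eq_mul_conjTranspose hX
  have h1 : V * (T * Tᴴ) * Vᴴ = (V * T) * (V * T)ᴴ := by
    rw [conjTranspose_mul]
    simp only [Matrix.mul_assoc]
  rw [h1, entropy_mul_conjTranspose_self, entropy_mul_conjTranspose_self, conjTranspose_mul,
    Matrix.mul_assoc, ← Matrix.mul_assoc Vᴴ, hV, Matrix.one_mul]

/-- The entropy is at most the entropy of the diagonal, with equality only for diagonal matrices. -/
lemma entropy_le_diag {X : Matrix n n ℂ} (hX : X.PosSemidef) :
    entropy X ≤ ∑ i, Real.negMulLog (X i i).re / Real.log 2 ∧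
      (entropy X = ∑ i, Real.negMulLog (X i i).re / Real.log 2 →
        X = diagonal fun i => ((X i i).re : ℂ)) := by
  obtain ⟨U, d, hU, hU', hd, hXd⟩ := exists_eq_unitary_diagonal hX
  have hlog : 0 < Real.log 2 := Real.log_pos (by norm_num)
  -- The weights `|U i k|²` are doubly stochastic: row sums allow Jensen for each diagonal entry,
  -- column sums recover the entropy from the eigenvalues.
  have hre : ∀ i, (X i i).re = ∑ k, Complex.normSq (U i k) • d k := by
    intro i
    rw [hXd, re_mul_diagonal_conjTranspose_apply_self]
    rfl
  have hS : entropy X = ∑ i, ∑ k, Complex.normSq (U i k) • Real.negMulLog (d k) / Real.log 2 := by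
    conv_lhs => rw [hXd, entropy_isometry_diagonal hU hd]
    rw [Finset.sum_comm]
    refine Finset.sum_congr rfl fun k _ => ?_
    simp only [smul_eq_mul]
    rw [← Finset.sum_div, ← Finset.sum_mul, sum_normSq_col hU, one_mul]
  have hle : ∀ i, ∑ k, Complex.normSq (U i k) • Real.negMulLog (d k) / Real.log 2 ≤
      Real.negMulLog (X i i).re / Real.log 2 := by
    intro i
    rw [hre, ← Finset.sum_div]
    exact div_le_div_of_nonneg_right (Real.concaveOn_negMulLog.le_map_sum
      (fun k _ => Complex.normSq_nonneg _) (sum_normSq_row hU' i) fun k _ => hd k) hlog.le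
  refine ⟨hS ▸ Finset.sum_le_sum fun i _ => hle i, fun heq => ?_⟩
  have hi := (Finset.sum_eq_sum_iff_of_le fun i _ => hle i).1 (hS.symm.trans heq)
  ext i j
  -- Equality in strict Jensen: every eigenvalue that row `i` of `U` sees equals `(X i i).re`. Hence
  -- `X i j` is `(X i i).re` times `(U Uᴴ) i j`.
  have hk : ∀ k, U i k * d k = U i k * (X i i).re := by
    intro k
    have h := hi i (Finset.mem_univ i)
    rw [hre, ← Finset.sum_div, div_left_inj' hlog.ne'] at h
    have := (Real.strictConcaveOn_negMulLog.map_sum_eq_iff'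
      (fun k _ => Complex.normSq_nonneg (U i k)) (sum_normSq_row hU' i) fun k _ => hd k).1 h.symm
      k (Finset.mem_univ k)
    rw [← hre] at this
    by_cases h0 : U i k = 0
    · simp [h0]
    · rw [this (by simpa using h0)]
  conv_lhs => rw [hXd, mul_diagonal_conjTranspose_apply]
  have : ∑ k, U i k * (X i i).re * star (U j k) = (X i i).re * (U * Uᴴ) i j := by
    rw [Matrix.mul_apply, Finset.mul_sum]
    refine Finset.sum_congr rfl fun k _ => ?_
    rw [conjTranspose_apply]
    ring
  simp only [hk]
  rw [this, hU', diagonal_apply, one_apply]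
  split_ifs <;> simp

/-- Strict concavity of the von Neumann entropy. -/
lemma sum_entropy_le {ι : Type*} [Fintype ι] {w : ι → ℝ} {X : ι → Matrix n n ℂ}
    (hw : ∀ i, 0 ≤ w i) (hw1 : ∑ i, w i = 1) (hX : ∀ i, (X i).PosSemidef) :
    ∑ i, w i * entropy (X i) ≤ entropy (∑ i, w i • X i) ∧
      (∑ i, w i * entropy (X i) = entropy (∑ i, w i • X i) →
        ∀ j, w j ≠ 0 → X j = ∑ i, w i • X i) := by
  have hlog : 0 < Real.log 2 := Real.log_pos (by norm_num)
  have hsum : (∑ i, w i • X i).PosSemidef :=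
    posSemidef_sum _ fun i _ => (hX i).smul (hw i)
  obtain ⟨U, d, hU, hU', hd, hXd⟩ := exists_eq_unitary_diagonal hsum
  -- In the eigenbasis of the average, concavity splits into two estimates: passing from each `Y i`
  -- to its diagonal (`h1`), then scalar Jensen entry by entry (`h2`). Equality overall forces
  -- equality in both.
  set Y : ι → Matrix n n ℂ := fun i => Uᴴ * X i * U with hY
  have hYp : ∀ i, (Y i).PosSemidef := fun i => (hX i).conjTranspose_mul_mul_same U
  have hYe : ∀ i, entropy (Y i) = entropy (X i) := by
    intro i
    have := entropy_isometry_conj (V := Uᴴ) (by simpa using hU') (hX i)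
    simpa using this
  have hYs : ∑ i, w i • Y i = diagonal fun k => (d k : ℂ) := by
    have : ∑ i, w i • Y i = Uᴴ * (∑ i, w i • X i) * U := by
      simp only [hY, Matrix.mul_sum, Matrix.sum_mul, Matrix.mul_smul, Matrix.smul_mul]
    rw [this, hXd]
    simp only [Matrix.mul_assoc]
    rw [hU, Matrix.mul_one, ← Matrix.mul_assoc, hU, Matrix.one_mul]
  have hdk : ∀ k, d k = ∑ i, w i • (Y i k k).re := by
    intro k
    have h := congrArg Complex.re (congrFun (congrFun hYs k) k)
    rw [diagonal_apply_eq, Complex.ofReal_re] at h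
    rw [← h, Matrix.sum_apply, Complex.re_sum]
    simp
  have hnn : ∀ i k, 0 ≤ (Y i k k).re := fun i k =>
    (Complex.le_def.1 (hYp i).diag_nonneg).1
  have hS : entropy (∑ i, w i • X i) = ∑ k, Real.negMulLog (d k) / Real.log 2 := by
    conv_lhs => rw [hXd]
    exact entropy_isometry_diagonal hU hd
  have h1 : ∀ i ∈ Finset.univ, w i * entropy (X i) ≤
      w i * ∑ k, Real.negMulLog (Y i k k).re / Real.log 2 := fun i _ =>
    mul_le_mul_of_nonneg_left (hYe i ▸ (entropy_le_diag (hYp i)).1) (hw i)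
  have hcomm : ∑ i, w i * ∑ k, Real.negMulLog (Y i k k).re / Real.log 2 =
      ∑ k, (∑ i, w i • Real.negMulLog (Y i k k).re) / Real.log 2 := by
    simp only [Finset.mul_sum, Finset.sum_div, smul_eq_mul]
    rw [Finset.sum_comm]
    simp only [mul_div_assoc]
  have h2 : ∀ k ∈ Finset.univ, (∑ i, w i • Real.negMulLog (Y i k k).re) / Real.log 2 ≤
      Real.negMulLog (d k) / Real.log 2 := by
    intro k _
    rw [hdk]
    exact div_le_div_of_nonneg_right (Real.concaveOn_negMulLog.le_map_sum
      (fun i _ => hw i) hw1 fun i _ => hnn i k) hlog.le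
  have h1s := Finset.sum_le_sum h1
  have h2s := Finset.sum_le_sum h2
  rw [hS]
  refine ⟨h1s.trans (hcomm.trans_le h2s), fun heq j hj => ?_⟩
  have e1 := (Finset.sum_eq_sum_iff_of_le h1).1
    (le_antisymm h1s ((hcomm.trans_le h2s).trans heq.ge)) j (Finset.mem_univ j)
  have e2 := (Finset.sum_eq_sum_iff_of_le h2).1
    (le_antisymm h2s (heq.symm.trans_le (h1s.trans hcomm.le)))
  have hYj : Y j = diagonal fun k => (d k : ℂ) := by
    rw [(entropy_le_diag (hYp j)).2 ((hYe j).trans (mul_left_cancel₀ hj e1))]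
    congr 1
    ext k
    have e3 := e2 k (Finset.mem_univ k)
    rw [hdk, div_left_inj' hlog.ne'] at e3
    have := (Real.strictConcaveOn_negMulLog.map_sum_eq_iff'
      (fun i _ => hw i) hw1 fun i _ => hnn i k).1 e3.symm j (Finset.mem_univ j) hj
    rw [this, ← hdk]
  rw [hXd, ← hYj]
  simp only [hY, Matrix.mul_assoc]
  rw [hU', Matrix.mul_one, ← Matrix.mul_assoc, hU', Matrix.one_mul]

lemma entropy_nonneg {X : Matrix n n ℂ} (hX : IsState X) : 0 ≤ entropy X := by
  obtain ⟨U, d, hU, -, hd, hXd⟩ := exists_eq_unitary_diagonal hX.1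
  have hlog : 0 < Real.log 2 := Real.log_pos (by norm_num)
  have htr : ∑ k, d k = 1 := by
    have h := hX.2
    rw [hXd, Matrix.trace_mul_comm, ← Matrix.mul_assoc, hU, Matrix.one_mul, trace_diagonal] at h
    exact_mod_cast h
  rw [hXd, entropy_isometry_diagonal hU hd]
  refine Finset.sum_nonneg fun k _ => div_nonneg (Real.negMulLog_nonneg (hd k) ?_) hlog.le
  rw [← htr]
  exact Finset.single_le_sum (fun i _ => hd i) (Finset.mem_univ k)

/-- Additivity of the von Neumann entropy. -/
lemma entropy_kronecker {X : Matrix n n ℂ} {Y : Matrix m m ℂ} (hX : IsState X) (hY : IsState Y) :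
    entropy (X ⊗ₖ Y) = entropy X + entropy Y := by
  obtain ⟨U, d, hU, -, hd, hXd⟩ := exists_eq_unitary_diagonal hX.1
  obtain ⟨W, e, hW, -, he, hYe⟩ := exists_eq_unitary_diagonal hY.1
  have htr : ∑ k, d k = 1 := by
    have h := hX.2
    rw [hXd, Matrix.trace_mul_comm, ← Matrix.mul_assoc, hU, Matrix.one_mul, trace_diagonal] at h
    exact_mod_cast h
  have htr' : ∑ k, e k = 1 := by
    have h := hY.2
    rw [hYe, Matrix.trace_mul_comm, ← Matrix.mul_assoc, hW, Matrix.one_mul, trace_diagonal] at h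
    exact_mod_cast h
  have hUW : (U ⊗ₖ W)ᴴ * (U ⊗ₖ W) = 1 := by
    rw [conjTranspose_kronecker, ← mul_kronecker_mul, hU, hW, one_kronecker_one]
  have hXY : X ⊗ₖ Y = (U ⊗ₖ W) * (diagonal fun i => ((d i.1 * e i.2 : ℝ) : ℂ)) * (U ⊗ₖ W)ᴴ := by
    rw [hXd, hYe, conjTranspose_kronecker, mul_kronecker_mul, mul_kronecker_mul,
      diagonal_kronecker_diagonal]
    simp
  rw [hXY, entropy_isometry_diagonal hUW fun i => mul_nonneg (hd _) (he _)]
  conv_rhs => rw [hXd, hYe, entropy_isometry_diagonal hU hd, entropy_isometry_diagonal hW he]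
  rw [Fintype.sum_prod_type]
  simp only [Real.negMulLog_mul, add_div, Finset.sum_add_distrib, mul_div_assoc, ← Finset.mul_sum,
    ← Finset.sum_mul, htr, htr', one_mul]

end Entropy

/-! ### Measurements on B and the upper bound. -/

/-- The operator `(1 ⊗ e†) M`, for a matrix `M` with rows indexed by `A × B` and a vector `e`
of `B`. -/
def slice {A B C : Type*} [Fintype B] (M : Matrix (A × B) C ℂ) (e : B → ℂ) : Matrix A C ℂ :=
  Matrix.of fun a c => ∑ b, star (e b) * M (a, b) c

lemma sum_slice_conjTranspose_mul {A B C ι : Type*} [Fintype A] [Fintype B]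
    [DecidableEq B] [Fintype ι] (M : Matrix (A × B) C ℂ)
    {F : ι → B → ℂ} (hF : ∑ i, vecMulVec (F i) (star (F i)) = 1) :
    ∑ i, (slice M (F i))ᴴ * slice M (F i) = Mᴴ * M := by
  ext c c'
  have hF' : ∀ b b', ∑ i, F i b * star (F i b') = if b = b' then 1 else 0 := by
    intro b b'
    have h := congrFun (congrFun hF b) b'
    simpa [Matrix.sum_apply, vecMulVec_apply, one_apply] using h
  have h1 : ∀ i, ((slice M (F i))ᴴ * slice M (F i)) c c' =
      ∑ a, ∑ b, ∑ b', (F i b * star (F i b')) * (star (M (a, b) c) * M (a, b') c') := by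
    intro i
    simp only [Matrix.mul_apply, slice, of_apply, conjTranspose_apply, star_sum, star_mul',
      star_star, Finset.sum_mul_sum]
    refine Finset.sum_congr rfl fun a _ => Finset.sum_congr rfl fun b _ =>
      Finset.sum_congr rfl fun b' _ => ?_
    ring
  rw [Matrix.sum_apply]
  simp only [h1]
  rw [Finset.sum_comm]
  simp only [Finset.sum_comm (s := (Finset.univ : Finset ι)), ← Finset.sum_mul, hF']
  simp [Matrix.mul_apply, Fintype.sum_prod_type]

section Measurement

variable {A B C : Type*} [Fintype A] [Fintype B] [Fintype C] [DecidableEq A]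

lemma outcomeProb_eq (ρ : Matrix (A × B) (A × B) ℂ) (E : Matrix B B ℂ) :
    outcomeProb ρ E = (traceB (((1 : Matrix A A ℂ) ⊗ₖ E) * ρ)).trace.re := by
  simp only [outcomeProb, traceB, Matrix.trace, Matrix.diag, Fintype.sum_prod_type, of_apply]

lemma traceB_one_kronecker_mul_apply (ρ : Matrix (A × B) (A × B) ℂ) (E : Matrix B B ℂ) (a a' : A) :
    traceB (((1 : Matrix A A ℂ) ⊗ₖ E) * ρ) a a' = ∑ b, ∑ b', E b b' * ρ (a, b') (a', b) := by
  simp only [traceB, of_apply, Matrix.mul_apply, Fintype.sum_prod_type, kroneckerMap_apply,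
    one_apply, ite_mul, one_mul, zero_mul]
  refine Finset.sum_congr rfl fun b _ => ?_
  rw [Finset.sum_comm]
  simp

/-- For a rank one effect the partial trace is the compression `⟨e|ρ|e⟩`, which has the form `X Xᴴ`
to which the factor swap applies. -/
lemma traceB_vecMulVec (M : Matrix (A × B) C ℂ) (e : B → ℂ) :
    traceB (((1 : Matrix A A ℂ) ⊗ₖ vecMulVec e (star e)) * (M * Mᴴ)) =
      slice M e * (slice M e)ᴴ := by
  ext a a'
  rw [traceB_one_kronecker_mul_apply]
  simp only [Matrix.mul_apply, slice, of_apply, conjTranspose_apply, vecMulVec_apply, Pi.star_apply,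
    star_sum, star_mul', star_star, Finset.sum_mul_sum]
  simp only [Finset.mul_sum]
  rw [Finset.sum_comm]
  conv_rhs => rw [Finset.sum_comm]
  refine Finset.sum_congr rfl fun b _ => ?_
  conv_rhs => rw [Finset.sum_comm]
  refine Finset.sum_congr rfl fun b' _ => Finset.sum_congr rfl fun c _ => ?_
  ring

lemma traceB_one_kronecker_sum_mul {ι : Type*} [Fintype ι] (ρ : Matrix (A × B) (A × B) ℂ)
    (E : ι → Matrix B B ℂ) :
    traceB (((1 : Matrix A A ℂ) ⊗ₖ ∑ i, E i) * ρ) =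
      ∑ i, traceB (((1 : Matrix A A ℂ) ⊗ₖ E i) * ρ) := by
  ext a a'
  simp only [Matrix.sum_apply, traceB_one_kronecker_mul_apply, Finset.sum_mul]
  rw [Finset.sum_comm]
  conv_rhs => rw [Finset.sum_comm]
  rw [Finset.sum_comm]
  exact Finset.sum_congr rfl fun b _ => Finset.sum_comm

variable [DecidableEq B]

lemma exists_sum_vecMulVec {E : Matrix B B ℂ} (hE : E.PosSemidef) :
    ∃ F : B → B → ℂ, E = ∑ k, vecMulVec (F k) (star (F k)) := by
  obtain ⟨T, rfl⟩ := exists_eq_mul_conjTranspose hE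
  refine ⟨fun k b => T b k, ?_⟩
  ext b b'
  simp [Matrix.mul_apply, Matrix.sum_apply, vecMulVec_apply]

/-- The product `(1 ⊗ E) ρ` need not be Hermitian; after splitting `E` into rank one terms, each
partial trace is some `X Xᴴ`. -/
lemma traceB_one_kronecker_mul_posSemidef {ρ : Matrix (A × B) (A × B) ℂ} {E : Matrix B B ℂ}
    (hρ : ρ.PosSemidef) (hE : E.PosSemidef) :
    (traceB (((1 : Matrix A A ℂ) ⊗ₖ E) * ρ)).PosSemidef := by
  obtain ⟨F, rfl⟩ := exists_sum_vecMulVec hE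
  obtain ⟨M, rfl⟩ := exists_eq_mul_conjTranspose hρ
  rw [traceB_one_kronecker_sum_mul]
  refine posSemidef_sum _ fun k _ => ?_
  rw [traceB_vecMulVec]
  exact posSemidef_self_mul_conjTranspose _

lemma outcomeProb_nonneg {ρ : Matrix (A × B) (A × B) ℂ} {E : Matrix B B ℂ}
    (hρ : ρ.PosSemidef) (hE : E.PosSemidef) : 0 ≤ outcomeProb ρ E := by
  rw [outcomeProb_eq]
  exact (Complex.le_def.1 (traceB_one_kronecker_mul_posSemidef hρ hE).trace_nonneg).1

lemma coe_outcomeProb {ρ : Matrix (A × B) (A × B) ℂ} {E : Matrix B B ℂ}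
    (hρ : ρ.PosSemidef) (hE : E.PosSemidef) :
    (outcomeProb ρ E : ℂ) = (traceB (((1 : Matrix A A ℂ) ⊗ₖ E) * ρ)).trace := by
  have h := (Complex.le_def.1 (traceB_one_kronecker_mul_posSemidef hρ hE).trace_nonneg).2
  rw [outcomeProb_eq]
  exact Complex.ext rfl h

lemma postState_isState {ρ : Matrix (A × B) (A × B) ℂ} {E : Matrix B B ℂ}
    (hρ : ρ.PosSemidef) (hE : E.PosSemidef) (hp : outcomeProb ρ E ≠ 0) :
    IsState (postState ρ E) := by
  refine ⟨(traceB_one_kronecker_mul_posSemidef hρ hE).smul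
    (inv_nonneg.2 (outcomeProb_nonneg hρ hE)), ?_⟩
  rw [postState, trace_smul, ← coe_outcomeProb hρ hE, Complex.real_smul, ← Complex.ofReal_mul,
    inv_mul_cancel₀ hp, Complex.ofReal_one]

lemma sum_outcomeProb {ι : Type*} [Fintype ι] {ρ : Matrix (A × B) (A × B) ℂ} (hρ : IsState ρ)
    {E : ι → Matrix B B ℂ} (hE1 : ∑ i, E i = 1) : ∑ i, outcomeProb ρ (E i) = 1 := by
  simp only [outcomeProb_eq]
  rw [← Complex.re_sum, ← trace_sum, ← traceB_one_kronecker_sum_mul, hE1, one_kronecker_one,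
    Matrix.one_mul]
  have h := congrArg Complex.re hρ.2
  simpa [traceB, Matrix.trace, Fintype.sum_prod_type] using h

lemma isPOVM_comp_equiv {ι : Type*} [Fintype ι] {E : ι → Matrix B B ℂ}
    (hE : ∀ i, (E i).PosSemidef) (hE1 : ∑ i, E i = 1) :
    IsPOVM fun j => E ((Fintype.equivFin ι).symm j) :=
  ⟨fun j => hE _, by rw [← hE1]; exact (Fintype.equivFin ι).symm.sum_comp E⟩

lemma measuredInfo_le {ρ : Matrix (A × B) (A × B) ℂ} (hρ : ρ.PosSemidef) {k : ℕ}
    {E : Fin k → Matrix B B ℂ} (hE : IsPOVM E) : measuredInfo ρ E ≤ entropy (traceB ρ) := by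
  refine sub_le_self _ (Finset.sum_nonneg fun i _ => ?_)
  by_cases hp : outcomeProb ρ (E i) = 0
  · simp [hp]
  · exact mul_nonneg (outcomeProb_nonneg hρ (hE.1 i))
      (entropy_nonneg (postState_isState hρ (hE.1 i) hp))

lemma le_classicalCorr {ρ : Matrix (A × B) (A × B) ℂ} (hρ : ρ.PosSemidef) {ι : Type*} [Fintype ι]
    {E : ι → Matrix B B ℂ} (hE : ∀ i, (E i).PosSemidef) (hE1 : ∑ i, E i = 1) :
    entropy (traceB ρ) - ∑ i, outcomeProb ρ (E i) * entropy (postState ρ (E i)) ≤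
      classicalCorr ρ := by
  -- The bound `S(A)` makes the real supremum genuine; an unbounded set would get the default value
  -- `0`.
  refine le_csSup ⟨entropy (traceB ρ), ?_⟩ ⟨_, _, isPOVM_comp_equiv hE hE1, ?_⟩
  · rintro x ⟨k, F, hF, rfl⟩
    exact measuredInfo_le hρ hF
  · rw [measuredInfo]
    congr 1
    exact (Fintype.equivFin ι).symm.sum_comp
      fun i => outcomeProb ρ (E i) * entropy (postState ρ (E i))

lemma classicalCorr_le {ρ : Matrix (A × B) (A × B) ℂ} {x : ℝ}
    (h : ∀ (k : ℕ) (E : Fin k → Matrix B B ℂ), IsPOVM E → measuredInfo ρ E ≤ x) :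
    classicalCorr ρ ≤ x := by
  refine csSup_le ⟨_, 1, fun _ => 1, ⟨fun _ => PosSemidef.one, by simp⟩, rfl⟩ ?_
  rintro y ⟨k, E, hE, rfl⟩
  exact h k E hE

variable [DecidableEq C]

lemma entropy_smul_mul_conjTranspose_self (M : Matrix A C ℂ) {c : ℝ} (hc : 0 ≤ c) :
    entropy (c • (M * Mᴴ)) = entropy (c • (Mᴴ * M)) := by
  have h := entropy_mul_conjTranspose_self (Real.sqrt c • M)
  rw [conjTranspose_smul, star_trivial, Matrix.smul_mul, Matrix.mul_smul, Matrix.smul_mul,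
    Matrix.mul_smul, smul_smul, smul_smul, Real.mul_self_sqrt hc] at h
  exact h

/-- A measurement with rank one effects leaves at most the entropy `S(ρ)` on average, and if it
leaves that much then all the slices have the same Gram matrix up to scale. -/
lemma sum_entropy_postState_le {ι : Type*} [Fintype ι] {M : Matrix (A × B) C ℂ}
    (hM : IsState (M * Mᴴ)) {F : ι → B → ℂ} (hF : ∑ i, vecMulVec (F i) (star (F i)) = 1) :
    (∑ i, outcomeProb (M * Mᴴ) (vecMulVec (F i) (star (F i))) *
        entropy (postState (M * Mᴴ) (vecMulVec (F i) (star (F i)))) ≤ entropy (M * Mᴴ)) ∧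
      (∑ i, outcomeProb (M * Mᴴ) (vecMulVec (F i) (star (F i))) *
        entropy (postState (M * Mᴴ) (vecMulVec (F i) (star (F i)))) = entropy (M * Mᴴ) →
        ∀ i, (slice M (F i))ᴴ * slice M (F i) =
          ((slice M (F i))ᴴ * slice M (F i)).trace • (Mᴴ * M)) := by
  set p : ι → ℝ := fun i => outcomeProb (M * Mᴴ) (vecMulVec (F i) (star (F i))) with hp
  have hpsd : ∀ i, (vecMulVec (F i) (star (F i))).PosSemidef := fun i =>
    posSemidef_vecMulVec_self_star _
  have hp0 : ∀ i, 0 ≤ p i := fun i => outcomeProb_nonneg hM.1 (hpsd i)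
  have hptr : ∀ i, (p i : ℂ) = ((slice M (F i))ᴴ * slice M (F i)).trace := by
    intro i
    rw [hp, coe_outcomeProb hM.1 (hpsd i), traceB_vecMulVec, Matrix.trace_mul_comm]
  set X : ι → Matrix C C ℂ := fun i => (p i)⁻¹ • ((slice M (F i))ᴴ * slice M (F i)) with hX
  have hXe : ∀ i, entropy (postState (M * Mᴴ) (vecMulVec (F i) (star (F i)))) =
      entropy (X i) := by
    intro i
    rw [postState, traceB_vecMulVec,
      entropy_smul_mul_conjTranspose_self _ (inv_nonneg.2 (hp0 i))]
  have hpX : ∀ i, p i • X i = (slice M (F i))ᴴ * slice M (F i) := by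
    intro i
    -- At probability zero the Gram matrix has trace zero, so the slice vanishes and the identity
    -- survives the default `0⁻¹ = 0`.
    by_cases h0 : p i = 0
    · have h := hptr i
      rw [h0, Complex.ofReal_zero, eq_comm, trace_conjTranspose_mul_self_eq_zero_iff] at h
      rw [h0, h]
      simp
    · rw [hX, smul_smul, mul_inv_cancel₀ h0, one_smul]
  have hsum : ∑ i, p i • X i = Mᴴ * M := by
    simp only [hpX]
    exact sum_slice_conjTranspose_mul M hF
  have hmain := sum_entropy_le hp0 (sum_outcomeProb hM hF) fun i =>
    (posSemidef_conjTranspose_mul_self (slice M (F i))).smul (inv_nonneg.2 (hp0 i))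
  change (∑ i, p i * entropy (X i) ≤ entropy (∑ i, p i • X i)) ∧
    (∑ i, p i * entropy (X i) = entropy (∑ i, p i • X i) →
      ∀ j, p j ≠ 0 → X j = ∑ i, p i • X i) at hmain
  rw [hsum, ← entropy_mul_conjTranspose_self] at hmain
  simp only [hXe]
  refine ⟨hmain.1, fun heq i => ?_⟩
  rw [← hptr]
  by_cases h0 : p i = 0
  · rw [← hpX, h0]
    simp
  · rw [← hmain.2 heq i h0, ← hpX]
    exact (Complex.coe_smul (p i) (X i)).symm

lemma sum_vecMulVec_single : ∑ b : B,
    vecMulVec (Pi.single b (1 : ℂ)) (star (Pi.single b 1)) = 1 := by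
  ext i j
  rw [Matrix.sum_apply]
  simp [vecMulVec_apply, Pi.single_apply, one_apply]

/-- Every unit vector is part of a resolution of the identity by rank one operators. -/
lemma exists_sum_vecMulVec_eq_one {e : B → ℂ} (he : star e ⬝ᵥ e = 1) :
    ∃ F : Option B → B → ℂ, F none = e ∧ ∑ i, vecMulVec (F i) (star (F i)) = 1 := by
  have hP : (1 - vecMulVec e (star e)) * (1 - vecMulVec e (star e))ᴴ =
      1 - vecMulVec e (star e) := by
    have hh : vecMulVec e (star e) * vecMulVec e (star e) = vecMulVec e (star e) := by
      rw [vecMulVec_mul_vecMulVec, he, one_smul]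
    rw [conjTranspose_sub, conjTranspose_one, (posSemidef_vecMulVec_self_star e).1.eq]
    simp only [Matrix.sub_mul, Matrix.mul_sub, Matrix.one_mul, Matrix.mul_one, hh]
    abel
  -- The remaining vectors are the columns of the projection `P = 1 - |e⟩⟨e|`; their rank one
  -- operators sum to `P Pᴴ = P`.
  refine ⟨fun i => i.elim e fun k b => (1 - vecMulVec e (star e)) b k, rfl, ?_⟩
  rw [Fintype.sum_option]
  have : ∑ k, vecMulVec (fun b => (1 - vecMulVec e (star e)) b k)
      (star fun b => (1 - vecMulVec e (star e)) b k) = 1 - vecMulVec e (star e) := by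
    conv_rhs => rw [← hP]
    ext b b'
    rw [Matrix.sum_apply, Matrix.mul_apply]
    rfl
  change vecMulVec e (star e) + ∑ k, vecMulVec (fun b => (1 - vecMulVec e (star e)) b k)
      (star fun b => (1 - vecMulVec e (star e)) b k) = 1
  rw [this]
  abel

/-- Any rank one measurement suffices; the standard basis is used. -/
lemma discord_le {ρ : Matrix (A × B) (A × B) ℂ} (hρ : IsState ρ) :
    discord ρ ≤ entropy (traceA ρ) := by
  obtain ⟨M, rfl⟩ := exists_eq_mul_conjTranspose hρ.1
  have h1 := (sum_entropy_postState_le hρ (sum_vecMulVec_single (B := B))).1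
  have h2 := le_classicalCorr hρ.1 (fun b => posSemidef_vecMulVec_self_star (Pi.single b (1 : ℂ)))
    (sum_vecMulVec_single (B := B))
  rw [discord, mutualInfo]
  linarith

/-- The hypothesis says `J(A|B) = S(A) - S(AB)`, so no measurement leaves less than `S(AB)` on
average. A rank one measurement containing `e` leaves no more, hence the equality case of concavity
applies. -/
lemma gram_slice_of_discord_eq {M : Matrix (A × B) C ℂ} (hM : IsState (M * Mᴴ))
    (h : discord (M * Mᴴ) = entropy (traceA (M * Mᴴ))) {e : B → ℂ} (he : star e ⬝ᵥ e = 1) :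
    (slice M e)ᴴ * slice M e = ((slice M e)ᴴ * slice M e).trace • (Mᴴ * M) := by
  obtain ⟨F, rfl, hF⟩ := exists_sum_vecMulVec_eq_one he
  have h1 := sum_entropy_postState_le hM hF
  have h2 := le_classicalCorr hM.1 (fun i => posSemidef_vecMulVec_self_star (F i)) hF
  refine h1.2 (le_antisymm h1.1 ?_) none
  rw [discord, mutualInfo] at h
  linarith

end Measurement

/-! ### Linear algebra: polarization, full rank factorizations, Gram matrices. -/

/-- A complex matrix with vanishing quadratic form is zero. -/
lemma eq_zero_of_forall_star_dotProduct_mulVec {B : Type*} [Fintype B] [DecidableEq B]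
    {K : Matrix B B ℂ} (hK : ∀ e : B → ℂ, star e ⬝ᵥ (K *ᵥ e) = 0) : K = 0 := by
  ext b b'
  -- Polarization: the vectors `b + b'` and `b + i b'` give the sum and the difference of the two
  -- off-diagonal entries.
  have h1 := hK (Pi.single b 1 + Pi.single b' 1)
  have h2 := hK (Pi.single b 1 + Complex.I • Pi.single b' 1)
  simp only [mulVec_add, mulVec_smul, star_add, star_smul, add_dotProduct, dotProduct_add,
    smul_dotProduct, dotProduct_smul, hK, smul_eq_mul] at h1 h2
  have hI : Complex.I * Complex.I = -1 := Complex.I_mul_I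
  have h3 : star (Pi.single b (1 : ℂ)) ⬝ᵥ (K *ᵥ Pi.single b' 1) = 0 := by
    simp only [Complex.star_def, Complex.conj_I] at h2
    linear_combination (1 / 2) * h1 - (Complex.I / 2) * h2 + (1 / 2) *
      (star (Pi.single b (1 : ℂ)) ⬝ᵥ (K *ᵥ Pi.single b' 1) -
        star (Pi.single b' (1 : ℂ)) ⬝ᵥ (K *ᵥ Pi.single b 1)) * hI
  simpa [← Pi.single_star] using h3

/-- A full rank factorization of a positive semidefinite matrix. -/
lemma exists_thin_factorization {n : Type*} [Fintype n] [DecidableEq n] {X : Matrix n n ℂ}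
    (hX : X.PosSemidef) :
    ∃ (m : ℕ) (T : Matrix n (Fin m) ℂ) (S : Matrix (Fin m) n ℂ), X = T * Tᴴ ∧ S * T = 1 := by
  classical
  obtain ⟨U, d, hU, -, hd, hXd⟩ := exists_eq_unitary_diagonal hX
  let e := Fintype.equivFin {k // d k ≠ 0}
  have hpos : ∀ k, d (e.symm k) ≠ 0 := fun k => (e.symm k).2
  -- `T = U √d` and `S = (√d)⁻¹ Uᴴ`, restricted to the nonzero eigenvalues so that `√d` is
  -- invertible.
  refine ⟨_, of fun i k => U i (e.symm k) * (Real.sqrt (d (e.symm k)) : ℂ),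
    of fun k i => (Real.sqrt (d (e.symm k)) : ℂ)⁻¹ * star (U i (e.symm k)), ?_, ?_⟩
  · ext i j
    conv_lhs => rw [hXd, mul_diagonal_conjTranspose_apply]
    rw [Matrix.mul_apply]
    simp only [of_apply, conjTranspose_apply]
    have h1 : ∀ k : {k // d k ≠ 0}, U i k * (Real.sqrt (d k) : ℂ) *
        star (U j k * (Real.sqrt (d k) : ℂ)) = U i k * d k * star (U j k) := by
      intro k
      have hs : (Real.sqrt (d k) : ℂ) * (Real.sqrt (d k) : ℂ) = d k := by
        rw [← Complex.ofReal_mul, Real.mul_self_sqrt (hd _)]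
      rw [star_mul', show star (Real.sqrt (d k) : ℂ) = Real.sqrt (d k) from Complex.conj_ofReal _,
        ← hs]
      ring
    rw [e.symm.sum_comp fun k : {k // d k ≠ 0} => U i k * (Real.sqrt (d k) : ℂ) *
        star (U j k * (Real.sqrt (d k) : ℂ))]
    simp only [h1]
    rw [← Finset.sum_filter_of_ne (p := fun k => d k ≠ 0)
      (fun k _ hk hd0 => hk (by rw [hd0, Complex.ofReal_zero, mul_zero, zero_mul]))]
    exact Finset.sum_subtype _ (by simp) _
  · ext k l
    have h := congrFun (congrFun hU (e.symm k)) (e.symm l)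
    rw [Matrix.mul_apply] at h ⊢
    simp only [of_apply, conjTranspose_apply] at h ⊢
    have hs : ∀ k, (Real.sqrt (d (e.symm k)) : ℂ) ≠ 0 := fun k => by
      rw [Complex.ofReal_ne_zero, Real.sqrt_ne_zero (hd _)]
      exact hpos k
    have h2 : ∑ i, (Real.sqrt (d (e.symm k)) : ℂ)⁻¹ * star (U i (e.symm k)) *
        (U i (e.symm l) * (Real.sqrt (d (e.symm l)) : ℂ)) =
        (Real.sqrt (d (e.symm k)) : ℂ)⁻¹ * (Real.sqrt (d (e.symm l)) : ℂ) *
          ∑ i, star (U i (e.symm k)) * U i (e.symm l) := by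
      rw [Finset.mul_sum]
      refine Finset.sum_congr rfl fun i _ => ?_
      ring
    rw [h2, h]
    by_cases hkl : k = l
    · subst hkl
      rw [one_apply_eq, one_apply_eq, mul_one, inv_mul_cancel₀ (hs k)]
    · have : ((e.symm k : {k // d k ≠ 0}) : n) ≠ e.symm l := fun hh =>
        hkl (e.symm.injective (Subtype.ext hh))
      rw [one_apply_ne hkl, one_apply_ne this, mul_zero]

/-- Matrices with the same Gram matrix differ by an isometry. -/
lemma exists_isometry_of_gram_eq {a c k : Type*} [Fintype a] [Fintype c] [Fintype k]
    [DecidableEq c] [DecidableEq k] {N : Matrix a c ℂ} {Q : Matrix c k ℂ} {W : Matrix k c ℂ}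
    (hN : Nᴴ * N = Q * Qᴴ) (hW : W * Q = 1) :
    ∃ V : Matrix a k ℂ, Vᴴ * V = 1 ∧ N = V * Qᴴ := by
  have hW' : Qᴴ * Wᴴ = 1 := by rw [← conjTranspose_mul, hW, conjTranspose_one]
  -- Forced by `N = V Qᴴ` and `Qᴴ Wᴴ = 1`.
  refine ⟨N * Wᴴ, ?_, ?_⟩
  · rw [conjTranspose_mul, conjTranspose_conjTranspose, Matrix.mul_assoc, ← Matrix.mul_assoc Nᴴ,
      hN, Matrix.mul_assoc Q, hW', Matrix.mul_one, hW]
  -- Its Gram matrix vanishes, because `Nᴴ N = Q Qᴴ` and `Qᴴ (1 - Wᴴ Qᴴ) = 0`.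
  · have h : N * (1 - Wᴴ * Qᴴ) = 0 := by
      rw [← conjTranspose_mul_self_eq_zero, conjTranspose_mul, Matrix.mul_assoc,
        ← Matrix.mul_assoc Nᴴ, hN, Matrix.mul_assoc Q, Matrix.mul_sub, ← Matrix.mul_assoc Qᴴ, hW']
      simp
    rw [Matrix.mul_sub, Matrix.mul_one, sub_eq_zero] at h
    rw [Matrix.mul_assoc]
    exact h

/-! ### Structure of the states that attain the bound. -/

section Structure

variable {A B C L R : Type*}

lemma stateTensorPure_eq [Fintype C]
    (T : Matrix L C ℂ) (ψ : R × B → ℂ) :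
    stateTensorPure (T * Tᴴ) ψ =
      (of fun (x : (L × R) × B) c => T x.1.1 c * ψ (x.1.2, x.2)) *
        (of fun (x : (L × R) × B) c => T x.1.1 c * ψ (x.1.2, x.2))ᴴ := by
  ext ⟨⟨l, r⟩, b⟩ ⟨⟨l', r'⟩, b'⟩
  simp only [stateTensorPure, submatrix_apply, Equiv.prodAssoc_apply, kroneckerMap_apply,
    vecMulVec_apply, Matrix.mul_apply, of_apply, conjTranspose_apply, Pi.star_apply, star_mul',
    Finset.sum_mul]
  refine Finset.sum_congr rfl fun c _ => ?_
  ring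

lemma slice_smul [Fintype B]
    (M : Matrix (A × B) C ℂ) (z : ℂ) (e : B → ℂ) :
    slice M (z • e) = star z • slice M e := by
  ext a c
  simp [slice, Finset.mul_sum, mul_assoc]

lemma slice_conjTranspose_mul_apply [Fintype A] [Fintype B]
    (M : Matrix (A × B) C ℂ) (e : B → ℂ) (c c' : C) :
    ((slice M e)ᴴ * slice M e) c c' =
      ∑ b, ∑ b', star (e b') * (∑ a, star (M (a, b) c) * M (a, b') c') * e b := by
  simp only [Matrix.mul_apply, slice, of_apply, conjTranspose_apply, star_sum, star_mul', star_star,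
    Finset.sum_mul_sum]
  rw [Finset.sum_comm]
  refine Finset.sum_congr rfl fun b _ => ?_
  rw [Finset.sum_comm]
  refine Finset.sum_congr rfl fun b' _ => ?_
  rw [Finset.mul_sum, Finset.sum_mul]
  refine Finset.sum_congr rfl fun a _ => ?_
  ring

/-- Both sides scale by `|z|²` when `e` is multiplied by `z`; freeing `e` from normalization is what
polarization needs. -/
lemma gram_slice_of_unit [Fintype A] [Fintype B] [Fintype C]
    {M : Matrix (A × B) C ℂ} {G : Matrix C C ℂ}
    (h : ∀ e : B → ℂ, star e ⬝ᵥ e = 1 →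
      (slice M e)ᴴ * slice M e = ((slice M e)ᴴ * slice M e).trace • G) (e : B → ℂ) :
    (slice M e)ᴴ * slice M e = ((slice M e)ᴴ * slice M e).trace • G := by
  by_cases he : e = 0
  · have : slice M e = 0 := by
      ext a c
      simp [slice, he]
    simp [this]
  · have hpos : 0 < star e ⬝ᵥ e := dotProduct_star_self_pos_iff.2 he
    obtain ⟨s, hs0, hs⟩ : ∃ s : ℝ, 0 < s ∧ (s : ℂ) = star e ⬝ᵥ e := by
      obtain ⟨h1, h2⟩ := Complex.lt_def.1 hpos
      exact ⟨_, h1, Complex.ext rfl h2⟩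
    have hq : (Real.sqrt s : ℂ) * (Real.sqrt s : ℂ) = s := by
      rw [← Complex.ofReal_mul, Real.mul_self_sqrt hs0.le]
    have hq0 : (Real.sqrt s : ℂ) ≠ 0 := by
      rw [Complex.ofReal_ne_zero]
      exact (Real.sqrt_pos.2 hs0).ne'
    have hu := h ((Real.sqrt s : ℂ)⁻¹ • e) (by
      rw [star_smul, smul_dotProduct, dotProduct_smul, ← hs, ← hq, star_inv₀, Complex.star_def,
        Complex.conj_ofReal, smul_eq_mul, smul_eq_mul]
      field_simp)
    have hcoe : star (star (Real.sqrt s : ℂ)⁻¹) = (Real.sqrt s : ℂ)⁻¹ := star_star _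
    rw [slice_smul, conjTranspose_smul, Matrix.smul_mul, Matrix.mul_smul, trace_smul, trace_smul,
      smul_smul, smul_assoc, smul_assoc, smul_smul] at hu
    refine smul_right_injective _ ?_ hu
    rw [hcoe, star_inv₀, Complex.star_def, Complex.conj_ofReal]
    exact mul_ne_zero (inv_ne_zero hq0) (inv_ne_zero hq0)

/-- If all slices of `M` have proportional Gram matrices, then the Gram matrix of the blocks of `M`
is a Kronecker product. -/
lemma gram_block_eq [Fintype A] [Fintype B] [Fintype C] [DecidableEq B]
    {M : Matrix (A × B) C ℂ} {G : Matrix C C ℂ}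
    (h : ∀ e : B → ℂ, (slice M e)ᴴ * slice M e = ((slice M e)ᴴ * slice M e).trace • G)
    (b b' : B) (c c' : C) :
    ∑ a, star (M (a, b) c) * M (a, b') c' =
      G c c' * ∑ c, ∑ a, star (M (a, b) c) * M (a, b') c := by
  -- For fixed `c`, `c'`, the quadratic form of `K` at `e` is the difference of the two sides of `h
  -- e` at entry `(c, c')`.
  let K : Matrix B B ℂ := of fun b' b => ∑ a, star (M (a, b) c) * M (a, b') c' -
      G c c' * ∑ c, ∑ a, star (M (a, b) c) * M (a, b') c
  have hK : K = 0 := by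
    refine eq_zero_of_forall_star_dotProduct_mulVec fun e => ?_
    have h1 := congrFun (congrFun (h e) c) c'
    rw [Matrix.smul_apply, smul_eq_mul, Matrix.trace, slice_conjTranspose_mul_apply] at h1
    simp only [diag_apply, slice_conjTranspose_mul_apply] at h1
    have h2 : star e ⬝ᵥ (K *ᵥ e) =
        (∑ b, ∑ b', star (e b') * (∑ a, star (M (a, b) c) * M (a, b') c') * e b) -
        (∑ c, ∑ b, ∑ b', star (e b') * (∑ a, star (M (a, b) c) * M (a, b') c) * e b) * G c c' := by
      simp only [dotProduct, mulVec, K, of_apply, Pi.star_apply,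
        Finset.mul_sum (s := Finset.univ (α := B))]
      rw [Finset.sum_comm]
      rw [Finset.sum_comm (s := (Finset.univ : Finset C)), Finset.sum_mul,
        ← Finset.sum_sub_distrib]
      refine Finset.sum_congr rfl fun b _ => ?_
      rw [Finset.sum_comm (s := (Finset.univ : Finset C)), Finset.sum_mul,
        ← Finset.sum_sub_distrib]
      refine Finset.sum_congr rfl fun b' _ => ?_
      rw [← Finset.sum_mul, ← Finset.mul_sum]
      ring
    rw [h2, h1, sub_self]
  have := congrFun (congrFun hK b') b
  exact sub_eq_zero.1 this

/-- Reshaped as a map `N` from CB to A, `M` has a Gram matrix that is a Kronecker product. Factoring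
both tensor factors with full rank gives a second matrix with that Gram matrix, `(T ⊗ D)ᴴ`, so `N =
V (Tᴴ ⊗ Dᴴ)`. Then `Tᴴ` yields `σ` and `Dᴴ`, read as a vector, yields `ψ`; `m` and `n` are the ranks
of `Mᴴ M` and `Pᴴ P`. -/
lemma exists_isStateTensorPure [Fintype A] [Fintype B] [Fintype C] [DecidableEq B] [DecidableEq C]
    {M : Matrix (A × B) C ℂ} (hM : (M * Mᴴ).trace = 1)
    (h : ∀ e : B → ℂ, (slice M e)ᴴ * slice M e = ((slice M e)ᴴ * slice M e).trace • (Mᴴ * M)) :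
    ∃ (m n : ℕ) (V : Matrix A (Fin m × Fin n) ℂ), Vᴴ * V = 1 ∧ IsStateTensorPure (M * Mᴴ) V := by
  classical
  let P : Matrix (A × C) B ℂ := of fun x b => M (x.1, b) x.2
  let N : Matrix A (C × B) ℂ := of fun a x => M (a, x.2) x.1
  have hN : Nᴴ * N = (Mᴴ * M) ⊗ₖ (Pᴴ * P) := by
    ext ⟨c, b⟩ ⟨c', b'⟩
    have h1 := gram_block_eq h b b' c c'
    rw [kroneckerMap_apply, Matrix.mul_apply, Matrix.mul_apply (M := Pᴴ), Fintype.sum_prod_type,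
      Finset.sum_comm]
    exact h1
  have htr : (Mᴴ * M).trace = 1 := by rw [Matrix.trace_mul_comm, hM]
  have htrP : (Pᴴ * P).trace = 1 := by
    rw [← htr]
    simp only [Matrix.trace, diag_apply, Matrix.mul_apply, Fintype.sum_prod_type]
    rw [Finset.sum_comm]
    conv_rhs => rw [Finset.sum_comm]
    refine Finset.sum_congr rfl fun a _ => ?_
    rw [Finset.sum_comm]
    conv_rhs => rw [Finset.sum_comm]
    exact Finset.sum_comm
  obtain ⟨m, T, S, hT, hS⟩ := exists_thin_factorization (posSemidef_conjTranspose_mul_self M)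
  obtain ⟨n, D, Z, hD, hZ⟩ := exists_thin_factorization (posSemidef_conjTranspose_mul_self P)
  obtain ⟨V, hV, hNV⟩ := exists_isometry_of_gram_eq (Q := T ⊗ₖ D) (W := S ⊗ₖ Z)
    (by rw [hN, hT, hD, conjTranspose_kronecker, mul_kronecker_mul])
    (by rw [← mul_kronecker_mul, hS, hZ, one_kronecker_one])
  let ψ : Fin n × B → ℂ := fun x => star (D x.2 x.1)
  have hMV : M = (V ⊗ₖ (1 : Matrix B B ℂ)) *
      of fun (x : (Fin m × Fin n) × B) c => Tᴴ x.1.1 c * ψ (x.1.2, x.2) := by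
    ext ⟨a, b⟩ c
    have h1 := congrFun (congrFun hNV a) (c, b)
    rw [Matrix.mul_apply] at h1 ⊢
    rw [Fintype.sum_prod_type]
    simp only [kroneckerMap_apply, one_apply, mul_ite, mul_one, mul_zero, ite_mul, zero_mul,
      Finset.sum_ite_eq, Finset.mem_univ, if_true, of_apply]
    refine h1.trans (Finset.sum_congr rfl fun x _ => ?_)
    simp [conjTranspose_apply, kroneckerMap_apply, ψ]
  refine ⟨m, n, V, hV, Tᴴ * Tᴴᴴ, ψ, ⟨posSemidef_self_mul_conjTranspose _, ?_⟩, ?_, ?_⟩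
  · rw [conjTranspose_conjTranspose, Matrix.trace_mul_comm, ← hT, htr]
  · rw [← htrP, hD, Matrix.trace]
    simp only [dotProduct, Fintype.sum_prod_type, diag_apply, Matrix.mul_apply, Pi.star_apply, ψ,
      star_star, conjTranspose_apply]
    exact Finset.sum_comm
  · rw [stateTensorPure_eq]
    conv_lhs => rw [hMV]
    rw [conjTranspose_mul]
    simp only [Matrix.mul_assoc]

lemma traceB_conj [Fintype B] [Fintype L] [DecidableEq B]
    (V : Matrix A L ℂ) (Y : Matrix (L × B) (L × B) ℂ) :
    traceB ((V ⊗ₖ (1 : Matrix B B ℂ)) * Y * (V ⊗ₖ (1 : Matrix B B ℂ))ᴴ) = V * traceB Y * Vᴴ := by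
  ext a a'
  simp only [traceB, of_apply, Matrix.mul_apply, Fintype.sum_prod_type, kroneckerMap_apply,
    conjTranspose_apply, one_apply, mul_ite, mul_one, mul_zero, ite_mul, zero_mul,
    Finset.sum_ite_eq,
    Finset.mem_univ, if_true, apply_ite star, star_zero, Finset.mul_sum, Finset.sum_mul]
  rw [Finset.sum_comm]
  refine Finset.sum_congr rfl fun l _ => ?_
  rw [Finset.sum_comm]

lemma traceB_one_kronecker_mul_conj [Fintype A] [Fintype B] [Fintype L]
    [DecidableEq A] [DecidableEq B] [DecidableEq L]
    (V : Matrix A L ℂ) (E : Matrix B B ℂ)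
    (Y : Matrix (L × B) (L × B) ℂ) :
    traceB (((1 : Matrix A A ℂ) ⊗ₖ E) *
      ((V ⊗ₖ (1 : Matrix B B ℂ)) * Y * (V ⊗ₖ (1 : Matrix B B ℂ))ᴴ)) =
      V * traceB (((1 : Matrix L L ℂ) ⊗ₖ E) * Y) * Vᴴ := by
  rw [← traceB_conj, ← Matrix.mul_assoc, ← Matrix.mul_assoc, ← Matrix.mul_assoc,
    ← mul_kronecker_mul, ← mul_kronecker_mul, Matrix.one_mul, Matrix.mul_one, Matrix.one_mul,
    Matrix.mul_one]

lemma traceB_stateTensorPure [Fintype B] [Fintype L] [Fintype R] [DecidableEq L] [DecidableEq R]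
    (σ : Matrix L L ℂ) (ψ : R × B → ℂ) (E : Matrix B B ℂ) :
    traceB (((1 : Matrix (L × R) (L × R) ℂ) ⊗ₖ E) * stateTensorPure σ ψ) =
      σ ⊗ₖ traceB (((1 : Matrix R R ℂ) ⊗ₖ E) * vecMulVec ψ (star ψ)) := by
  ext ⟨l, r⟩ ⟨l', r'⟩
  simp only [kroneckerMap_apply, traceB_one_kronecker_mul_apply, stateTensorPure, submatrix_apply,
    Equiv.prodAssoc_apply, Finset.mul_sum]
  refine Finset.sum_congr rfl fun b _ => Finset.sum_congr rfl fun b' _ => ?_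
  ring

lemma isState_vecMulVec [Fintype R]
    {ψ : R → ℂ} (hψ : star ψ ⬝ᵥ ψ = 1) : IsState (vecMulVec ψ (star ψ)) :=
  ⟨posSemidef_vecMulVec_self_star ψ, by rw [trace_vecMulVec, dotProduct_comm, hψ]⟩

/-- Swapping the factors from `stateTensorPure_eq` leaves `Tᴴ T` times the squared norm of `ψ`. -/
lemma entropy_stateTensorPure [Fintype B] [Fintype L] [Fintype R]
    [DecidableEq B] [DecidableEq L] [DecidableEq R]
    {σ : Matrix L L ℂ} (hσ : σ.PosSemidef) {ψ : R × B → ℂ}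
    (hψ : star ψ ⬝ᵥ ψ = 1) : entropy (stateTensorPure σ ψ) = entropy σ := by
  obtain ⟨T, rfl⟩ := exists_eq_mul_conjTranspose hσ
  rw [stateTensorPure_eq, entropy_mul_conjTranspose_self, entropy_mul_conjTranspose_self]
  congr 1
  ext c c'
  rw [dotProduct, Fintype.sum_prod_type] at hψ
  simp only [Matrix.mul_apply, Fintype.sum_prod_type, conjTranspose_apply, of_apply, star_mul']
  refine Finset.sum_congr rfl fun l _ => ?_
  rw [← mul_one (star (T l c) * T l c'), ← hψ, Finset.mul_sum]
  refine Finset.sum_congr rfl fun r _ => ?_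
  rw [Finset.mul_sum]
  refine Finset.sum_congr rfl fun b _ => ?_
  rw [Pi.star_apply]
  ring

lemma stateTensorPure_posSemidef [Fintype B] [Fintype L] [Fintype R] [DecidableEq L]
    {σ : Matrix L L ℂ} (hσ : σ.PosSemidef) (ψ : R × B → ℂ) :
    (stateTensorPure σ ψ).PosSemidef := by
  obtain ⟨T, rfl⟩ := exists_eq_mul_conjTranspose hσ
  rw [stateTensorPure_eq]
  exact posSemidef_self_mul_conjTranspose _

/-- Each outcome of nonzero probability leaves `V (σ ⊗ τ) Vᴴ` with `τ` a state of R, and `S(σ) +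
S(τ) ≥ S(σ) = S(AB)`. -/
lemma classicalCorr_le_of_isStateTensorPure [Fintype A] [Fintype B] [Fintype L] [Fintype R]
    [DecidableEq A] [DecidableEq B] [DecidableEq L] [DecidableEq R]
    {ρ : Matrix (A × B) (A × B) ℂ} (hρ : IsState ρ)
    {V : Matrix A (L × R) ℂ} (hV : Vᴴ * V = 1) (h : IsStateTensorPure ρ V) :
    classicalCorr ρ ≤ entropy (traceB ρ) - entropy ρ := by
  obtain ⟨σ, ψ, hσ, hψ, hρV⟩ := h
  refine classicalCorr_le fun k E hE => sub_le_sub_left ?_ _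
  have hψs := isState_vecMulVec hψ
  have hV1 : (V ⊗ₖ (1 : Matrix B B ℂ))ᴴ * (V ⊗ₖ (1 : Matrix B B ℂ)) = 1 := by
    rw [conjTranspose_kronecker, ← mul_kronecker_mul, hV, conjTranspose_one, Matrix.one_mul,
      one_kronecker_one]
  have hSρ : entropy ρ = entropy σ := by
    rw [hρV, entropy_isometry_conj hV1 (stateTensorPure_posSemidef hσ.1 ψ),
      entropy_stateTensorPure hσ.1 hψ]
  have htb : ∀ i, traceB (((1 : Matrix A A ℂ) ⊗ₖ E i) * ρ) =
      V * (σ ⊗ₖ traceB (((1 : Matrix R R ℂ) ⊗ₖ E i) * vecMulVec ψ (star ψ))) * Vᴴ := by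
    intro i
    rw [hρV, traceB_one_kronecker_mul_conj, traceB_stateTensorPure]
  have hp : ∀ i, outcomeProb ρ (E i) = outcomeProb (vecMulVec ψ (star ψ)) (E i) := by
    intro i
    rw [outcomeProb_eq, outcomeProb_eq, htb, Matrix.trace_mul_comm, ← Matrix.mul_assoc, hV,
      Matrix.one_mul, trace_kronecker, hσ.2, one_mul]
  have hpost : ∀ i, postState ρ (E i) =
      V * (σ ⊗ₖ postState (vecMulVec ψ (star ψ)) (E i)) * Vᴴ := by
    intro i
    rw [postState, postState, htb, hp, kronecker_smul, Matrix.mul_smul, Matrix.smul_mul]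
  rw [hSρ, ← one_mul (entropy σ), ← sum_outcomeProb hρ hE.2, Finset.sum_mul]
  refine Finset.sum_le_sum fun i _ => ?_
  by_cases h0 : outcomeProb ρ (E i) = 0
  · simp [h0]
  · refine mul_le_mul_of_nonneg_left ?_ (outcomeProb_nonneg hρ.1 (hE.1 i))
    have hs := postState_isState hψs.1 (hE.1 i) (hp i ▸ h0)
    rw [hpost, entropy_isometry_conj hV (hσ.1.kronecker hs.1), entropy_kronecker hσ hs]
    linarith [entropy_nonneg hs]

/-- The range of the reduced state lies in that of `V`, so `1 - V Vᴴ` annihilates an invertible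
matrix. -/
lemma mul_conjTranspose_eq_one_of_posDef [Fintype A] [Fintype B] [Fintype L] [Fintype R]
    [DecidableEq A] [DecidableEq B] [DecidableEq L] [DecidableEq R]
    {ρ : Matrix (A × B) (A × B) ℂ}
    {V : Matrix A (L × R) ℂ} (hV : Vᴴ * V = 1) (h : IsStateTensorPure ρ V)
    (hpos : (traceB ρ).PosDef) : V * Vᴴ = 1 := by
  obtain ⟨σ, ψ, -, -, rfl⟩ := h
  have h1 : (1 - V * Vᴴ) * traceB ((V ⊗ₖ (1 : Matrix B B ℂ)) * stateTensorPure σ ψ *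
      (V ⊗ₖ (1 : Matrix B B ℂ))ᴴ) = 0 := by
    have h2 : (1 - V * Vᴴ) * V = 0 := by
      rw [Matrix.sub_mul, Matrix.one_mul, Matrix.mul_assoc, hV, Matrix.mul_one, sub_self]
    rw [traceB_conj, ← Matrix.mul_assoc, ← Matrix.mul_assoc, h2, Matrix.zero_mul, Matrix.zero_mul]
  exact (sub_eq_zero.1 (hpos.isUnit.mul_left_eq_zero.1 h1)).symm

lemma discord_eq_iff [Fintype A] [Fintype B] [DecidableEq A] [DecidableEq B]
    {ρ : Matrix (A × B) (A × B) ℂ} (hρ : IsState ρ) :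
    discord ρ = entropy (traceA ρ) ↔
      ∃ (m n : ℕ) (V : Matrix A (Fin m × Fin n) ℂ), Vᴴ * V = 1 ∧ IsStateTensorPure ρ V := by
  constructor
  · intro h
    obtain ⟨M, rfl⟩ := exists_eq_mul_conjTranspose hρ.1
    exact exists_isStateTensorPure hρ.2
      (gram_slice_of_unit fun e he => gram_slice_of_discord_eq hρ h he)
  · rintro ⟨m, n, V, hV, h⟩
    have := classicalCorr_le_of_isStateTensorPure hρ hV h
    refine le_antisymm (discord_le hρ) ?_
    rw [discord, mutualInfo]
    linarith

end Structure

end QuantumDiscord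

theorem theorem1 {A B : Type*} [Fintype A] [Fintype B] [DecidableEq A] [DecidableEq B]
    (ρ : Matrix (A × B) (A × B) ℂ) (hρ : QuantumDiscord.IsState ρ) :
    -- the upper bound
    QuantumDiscord.discord ρ ≤ QuantumDiscord.entropy (QuantumDiscord.traceA ρ) ∧
    -- the equality case: `V` is an isometry, that is, it identifies `ℂ^m ⊗ ℂ^n` with a
    -- subspace of the Hilbert space of `A`
    (QuantumDiscord.discord ρ = QuantumDiscord.entropy (QuantumDiscord.traceA ρ) ↔
      ∃ (m n : ℕ) (V : Matrix A (Fin m × Fin n) ℂ),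
        Vᴴ * V = 1 ∧ QuantumDiscord.IsStateTensorPure ρ V) ∧
    -- the equality case when the reduced state of `A` has full support: `V` is unitary, that is,
    -- it identifies `ℂ^m ⊗ ℂ^n` with the whole Hilbert space of `A`
    ((QuantumDiscord.traceB ρ).PosDef →
      (QuantumDiscord.discord ρ = QuantumDiscord.entropy (QuantumDiscord.traceA ρ) ↔
        ∃ (m n : ℕ) (V : Matrix A (Fin m × Fin n) ℂ),
          Vᴴ * V = 1 ∧ V * Vᴴ = 1 ∧ QuantumDiscord.IsStateTensorPure ρ V)) := by
  refine ⟨QuantumDiscord.discord_le hρ, QuantumDiscord.discord_eq_iff hρ, fun hpos => ?_⟩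
  rw [QuantumDiscord.discord_eq_iff hρ]
  constructor
  · rintro ⟨m, n, V, hV, h⟩
    exact ⟨m, n, V, hV, QuantumDiscord.mul_conjTranspose_eq_one_of_posDef hV h hpos, h⟩
  · rintro ⟨m, n, V, hV, -, h⟩
    exact ⟨m, n, V, hV, h⟩
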